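/- Let \(L^2(\mathbb R)\) be the Hilbert space of complex-valued square-integrable functions, let \(H^1(\mathbb R)\) be the subspace of all \(f\in L^2(\mathbb R)\) with a weak derivative \(f'\in L^2(\mathbb R)\), and let \(A\) be the momentum operator with domain \(\mathcal D(A)=H^1(\mathbb R)\) and \(Af=if'\). For a linear subspace \(\mathfrak M\subset\mathcal D(A^*)\) consider the condition \[(\ast)\qquad \ker(A^*)\cap\mathfrak M=\{0\}\quad\text{and}\quad \{A^*\phi:\phi\in\mathfrak M\}\cap\mathcal D(A)=\{0\}.\] If \((\ast)\) holds, let \(A_{\mathfrak M}\) be the (then well-defined) extension of \(A\) with domain \(\mathcal D(A)\dotplus\{A^*\phi:\phi\in\mathfrak M\}\) and \(A_{\mathfrak M}(f+A^*\phi)=Af-\phi\). Let \(\overline{\mathfrak M}\) be the closure of \(\mathfrak M\) in \(\mathcal D(A^*)\) with respect to the graph norm \((\|\phi\|^2+\|A^*\phi\|^2)^{1/2}\). For \(\lambda\in\mathbb R\) let \(\phi_\lambda(x)=\tfrac12e^{-|x-\lambda|}\), and put \[\mathfrak M_{\mathbb Q}=\operatorname{span}\{\phi_\lambda:\lambda\in\mathbb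 Q\},\qquad \mathfrak M_{\mathbb Z}=\operatorname{span}\{\phi_\lambda:\lambda\in\mathbb Z\}\] (finite complex linear combinations). Then: 1. \(A\) is densely defined and selfadjoint. The spaces \(\mathfrak M_{\mathbb Q}\) and \(\mathfrak M_{\mathbb Z}\) are infinite-dimensional, are contained in \(\mathcal D(A^*)\) and satisfy \((\ast)\); moreover \(A^*\phi\notin\mathcal D(A)\) for every nonzero \(\phi\) in \(\mathfrak M_{\mathbb Q}\) or in \(\mathfrak M_{\mathbb Z}\). Both \(A_{\mathfrak M_{\mathbb Q}}\) and \(A_{\mathfrak M_{\mathbb Z}}\) extend \(A\). 2. \(\overline{\mathfrak M_{\mathbb Q}}\) does not satisfy \((\ast)\), the operator \(A_{\mathfrak M_{\mathbb Q}}\) is not closable, and its adjoint has the trivial domain \(\{0\}\). 3. \(\overline{\mathfrak M_{\mathbb Z}}\) satisfies \((\ast)\), the operator \(A_{\mathfrak M_{\mathbb Z}}\) is closable, and its adjoint is a densely defined restriction of \(A^*\). -/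

import Mathlib

open MeasureTheory

noncomputable section

namespace ClosedExt

/-! ### Extensions of a densely defined closed operator on a complex Hilbert space -/

section Abstract

variable {H : Type*} [NormedAddCommGroup H] [InnerProductSpace ℂ H] [CompleteSpace H]

/-- For a linear set `M ⊆ D(A*)`:
`ker A* ∩ M = {0}` and `{A*φ : φ ∈ M} ∩ D(A) = {0}`. -/
def ExtensionCondition (A : H →ₗ.[ℂ] H) (M : Set H) : Prop :=
  M ⊆ (A.adjoint.domain : Set H) ∧
  {φ : H | ∃ h : φ ∈ A.adjoint.domain, A.adjoint ⟨φ, h⟩ = 0} ∩ M = {0} ∧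
  {ψ : H | ∃ φ : A.adjoint.domain, (φ : H) ∈ M ∧ A.adjoint φ = ψ} ∩ (A.domain : Set H) = {0}

/-- The graph norm `(‖x‖² + ‖T x‖²)^{1/2}` on the domain of `T`. -/
def graphNorm (T : H →ₗ.[ℂ] H) (x : T.domain) : ℝ :=
  √(‖(x : H)‖ ^ 2 + ‖T x‖ ^ 2)

/-- The closure of `M` in the domain of `T` with respect to the graph norm of `T`. -/
def graphNormClosure (T : H →ₗ.[ℂ] H) (M : Set H) : Set H :=
  {φ | ∃ h : φ ∈ T.domain, ∀ ε > 0, ∃ ψ : T.domain, (ψ : H) ∈ M ∧ graphNorm T (⟨φ, h⟩ - ψ) < ε}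

/-- The linear set of all pairs `(f + A*φ, A f - φ)` with `f ∈ D(A)` and
`φ ∈ M ∩ D(A*)`. -/
def extensionGraph (A : H →ₗ.[ℂ] H) (M : Submodule ℂ H) : Submodule ℂ (H × H) where
  carrier := {p | ∃ (f : A.domain) (φ : A.adjoint.domain), (φ : H) ∈ M ∧
    p = ((f : H) + A.adjoint φ, A f - (φ : H))}
  zero_mem' := ⟨0, 0, by simp, by simp [LinearPMap.map_zero]; rfl⟩
  add_mem' := by
    rintro _ _ ⟨f, φ, hφ, rfl⟩ ⟨g, ψ, hψ, rfl⟩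
    refine ⟨f + g, φ + ψ, by simpa using M.add_mem hφ hψ, ?_⟩
    simp only [LinearPMap.map_add, Submodule.coe_add, Prod.mk_add_mk]
    congr 1 <;> abel
  smul_mem' := by
    rintro c _ ⟨f, φ, hφ, rfl⟩
    refine ⟨c • f, c • φ, by simpa using M.smul_mem c hφ, ?_⟩
    simp [LinearPMap.map_smul, smul_add, smul_sub]

/-- The operator `A_M` with domain `D(A) + {A*φ : φ ∈ M}` and `A_M (f + A*φ) = A f - φ`.
It is well defined as soon as `ExtensionCondition A M` holds (see `extension_graph`). -/
def extension (A : H →ₗ.[ℂ] H) (M : Submodule ℂ H) : H →ₗ.[ℂ] H :=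
  (extensionGraph A M).toLinearPMap

theorem extension_graph (A : H →ₗ.[ℂ] H) (M : Submodule ℂ H)
    (h : ExtensionCondition A (M : Set H)) :
    (extension A M).graph = extensionGraph A M := by
  refine Submodule.toLinearPMap_graph_eq _ ?_
  rintro _ ⟨f, φ, hφ, rfl⟩ h0
  simp only at h0 ⊢
  have h1 : A.adjoint φ = -(f : H) := (neg_eq_of_add_eq_zero_right h0).symm
  have h2 : A.adjoint φ = 0 := by
    have hm : A.adjoint φ ∈ ({0} : Set H) := by
      rw [← h.2.2]
      exact ⟨⟨φ, hφ, rfl⟩, by rw [h1]; exact A.domain.neg_mem f.2⟩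
    simpa using hm
  have h3 : (φ : H) = 0 := by
    have hm : (φ : H) ∈ ({0} : Set H) := by
      rw [← h.2.1]
      exact ⟨⟨φ.2, h2⟩, hφ⟩
    simpa using hm
  have h4 : f = 0 := by
    apply Subtype.ext
    rw [h2] at h0
    simpa using h0
  rw [h3, h4]
  simp

end Abstract

/-! ### The momentum operator on the real line -/

/-- The Hilbert space `L²(ℝ)` of complex-valued functions. -/
abbrev L2 : Type := Lp ℂ 2 (volume : Measure ℝ)

/-- `g` is the weak derivative of `f`. -/
def HasWeakDeriv (f g : L2) : Prop :=
  ∀ η : ℝ → ℝ, ContDiff ℝ (⊤ : ℕ∞) η → HasCompactSupport η →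
    ∫ x, deriv η x • f x = -∫ x, η x • g x

theorem L2.integrable_smul (f : L2) {η : ℝ → ℝ} (hη : Continuous η) (hc : HasCompactSupport η) :
    Integrable (fun x => η x • f x) :=
  ((Lp.memLp f).locallyIntegrable (by norm_num)).integrable_smul_left_of_hasCompactSupport hη hc

theorem HasWeakDeriv.unique {f g g' : L2} (h : HasWeakDeriv f g) (h' : HasWeakDeriv f g') :
    g = g' := by
  apply Lp.ext
  refine ae_eq_of_integral_contDiff_smul_eq ((Lp.memLp g).locallyIntegrable (by norm_num))
    ((Lp.memLp g').locallyIntegrable (by norm_num)) fun η hη hc => ?_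
  exact neg_injective ((h η hη hc).symm.trans (h' η hη hc))

theorem HasWeakDeriv.add {f g f' g' : L2} (h : HasWeakDeriv f g) (h' : HasWeakDeriv f' g') :
    HasWeakDeriv (f + f') (g + g') := by
  intro η hη hc
  have hd : Continuous (deriv η) := hη.continuous_deriv (by norm_num)
  have e1 : ∫ x, deriv η x • (f + f') x = ∫ x, (deriv η x • f x + deriv η x • f' x) := by
    refine integral_congr_ae ?_
    filter_upwards [Lp.coeFn_add f f'] with x hx
    rw [hx, Pi.add_apply, smul_add]
  have e2 : ∫ x, η x • (g + g') x = ∫ x, (η x • g x + η x • g' x) := by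
    refine integral_congr_ae ?_
    filter_upwards [Lp.coeFn_add g g'] with x hx
    rw [hx, Pi.add_apply, smul_add]
  rw [e1, e2, integral_add (f.integrable_smul hd hc.deriv) (f'.integrable_smul hd hc.deriv),
    integral_add (g.integrable_smul hη.continuous hc) (g'.integrable_smul hη.continuous hc),
    h η hη hc, h' η hη hc, neg_add]

theorem HasWeakDeriv.smul {f g : L2} (c : ℂ) (h : HasWeakDeriv f g) :
    HasWeakDeriv (c • f) (c • g) := by
  intro η hη hc
  have e1 : ∫ x, deriv η x • (c • f) x = ∫ x, c • (deriv η x • f x) := by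
    refine integral_congr_ae ?_
    filter_upwards [Lp.coeFn_smul c f] with x hx
    rw [hx, Pi.smul_apply, smul_comm]
  have e2 : ∫ x, η x • (c • g) x = ∫ x, c • (η x • g x) := by
    refine integral_congr_ae ?_
    filter_upwards [Lp.coeFn_smul c g] with x hx
    rw [hx, Pi.smul_apply, smul_comm]
  rw [e1, e2, integral_smul, integral_smul, h η hη hc, smul_neg]

/-- The Sobolev space `H¹(ℝ)`, as a subspace of `L²(ℝ)`. -/
def sobolevH1 : Submodule ℂ L2 where
  carrier := {f | ∃ g, HasWeakDeriv f g}
  zero_mem' := ⟨0, by simpa using HasWeakDeriv.smul (f := 0) (g := 0) 0 (by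
    intro η _ _
    have e : ∀ ζ : ℝ → ℝ, ∫ x, ζ x • (0 : L2) x = 0 := fun ζ => by
      refine integral_eq_zero_of_ae ?_
      filter_upwards [Lp.coeFn_zero ℂ 2 (volume : Measure ℝ)] with x hx
      rw [hx]; simp
    rw [e, e, neg_zero])⟩
  add_mem' := fun ⟨g, hg⟩ ⟨g', hg'⟩ => ⟨g + g', hg.add hg'⟩
  smul_mem' := fun c _ ⟨g, hg⟩ => ⟨c • g, hg.smul c⟩

/-- The weak derivative `f ↦ f'` as a linear map `H¹(ℝ) → L²(ℝ)`. -/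
def weakDeriv : sobolevH1 →ₗ[ℂ] L2 where
  toFun f := f.2.choose
  map_add' f g := (f + g).2.choose_spec.unique (f.2.choose_spec.add g.2.choose_spec)
  map_smul' c f := (c • f).2.choose_spec.unique (f.2.choose_spec.smul c)

theorem hasWeakDeriv_weakDeriv (f : sobolevH1) : HasWeakDeriv f (weakDeriv f) := f.2.choose_spec

/-- The momentum operator `f ↦ i f'` with domain `H¹(ℝ)`. -/
def momentum : L2 →ₗ.[ℂ] L2 where
  domain := sobolevH1
  toFun := Complex.I • weakDeriv

/-! ### The functions `φ_λ` and their spans -/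

/-- The function `x ↦ e^{-|x - l|} / 2`. -/
def phiFun (l : ℝ) (x : ℝ) : ℂ := ((1 / 2 * Real.exp (-|x - l|) : ℝ) : ℂ)

theorem memLp_phiFun (l : ℝ) : MemLp (phiFun l) 2 (volume : Measure ℝ) := by
  have hcont : Continuous (phiFun l) := by unfold phiFun; fun_prop
  rw [memLp_two_iff_integrable_sq_norm hcont.aestronglyMeasurable]
  have hI : Integrable (fun x : ℝ => Real.exp (-2 * |x|)) := by
    rw [← integrableOn_univ, ← Set.Iic_union_Ioi (a := (0 : ℝ))]
    refine IntegrableOn.union ?_ ?_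
    · refine (integrableOn_exp_mul_Iic (a := 2) (by norm_num) 0).congr_fun (fun x hx => ?_)
        measurableSet_Iic
      simp [abs_of_nonpos (Set.mem_Iic.mp hx)]
    · refine (integrableOn_exp_mul_Ioi (a := -2) (by norm_num) 0).congr_fun (fun x hx => ?_)
        measurableSet_Ioi
      simp [abs_of_pos (Set.mem_Ioi.mp hx)]
  refine ((hI.comp_sub_right l).const_mul (1 / 4)).congr (Filter.Eventually.of_forall fun x => ?_)
  simp only [phiFun, Complex.norm_real, Real.norm_eq_abs, sq_abs, mul_pow, ← Real.exp_nat_mul]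
  norm_num

/-- The function `φ_l(x) = e^{-|x - l|} / 2` as an element of `L²(ℝ)`. -/
def phi (l : ℝ) : L2 := (memLp_phiFun l).toLp (phiFun l)

/-- `span {φ_l : l ∈ ℚ}`. -/
def MQ : Submodule ℂ L2 := Submodule.span ℂ (Set.range fun q : ℚ => phi (q : ℝ))

/-- `span {φ_l : l ∈ ℤ}`. -/
def MZ : Submodule ℂ L2 := Submodule.span ℂ (Set.range fun z : ℤ => phi (z : ℝ))

end ClosedExt

end

noncomputable section

namespace ClosedExt

open Filter Topology Convolution

/-! In the graph inner product `⟪u, f⟫ + ⟪u', f'⟫` on `H¹(ℝ)`, the function `phi l` represents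
evaluation at `l`: it is the Green's function of `1 - d²/dx²`, with a kink at `l`
(`inner_phi_add_inner_dphi`). Everything is therefore governed by vanishing on `S`, for `S` the set
of indices of the span.

If `S` is closed and null and `f` in the closed span of `{phi l : l ∈ S}` has `f'' ∈ L²`, then `f -
f''` vanishes off `S`, hence almost everywhere, and `f = 0` (`eq_zero_of_mem_closure_span_phiPair`).
Since `A*φ ∈ D(A)` means that `φ` is twice weakly differentiable, this gives `(∗)` for the closure
when `S = ℤ`. It gives `(∗)` for the span itself for every `S`, because a finite combination
involves only a finite set of indices.

If `S` is dense, an `H¹` function vanishing on `S` is zero (`eq_zero_of_inner_phi`), so the span is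
dense in `H¹(ℝ)`. Its closure then contains all test functions and `(∗)` fails.

The adjoint of the extension is `A*` restricted to functions orthogonal to the span in the graph
inner product, that is, vanishing on `S`. For dense `S` only `0` remains. For closed null `S` the
test functions vanishing on `S` remain, and they are dense in `L²`. -/

/-- Real test functions on the line. -/
@[ext]
structure TestFun where
  /-- The underlying function. -/
  toFun : ℝ → ℝ
  contDiff : ContDiff ℝ (⊤ : ℕ∞) toFun
  hasCompactSupport : HasCompactSupport toFun

/-! ### Test functions as elements of `L²(ℝ)`. -/

namespace TestFun

instance : CoeFun TestFun fun _ => ℝ → ℝ := ⟨TestFun.toFun⟩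

/-- The derivative of a test function. -/
def deriv (η : TestFun) : TestFun :=
  ⟨_root_.deriv η, (contDiff_infty_iff_deriv.mp η.contDiff).2, η.hasCompactSupport.deriv⟩

/-- Reflection of a test function at a point. -/
def reflect (η : TestFun) (a : ℝ) : TestFun :=
  ⟨fun t => η (a - t), η.contDiff.comp (by fun_prop),
    η.hasCompactSupport.comp_homeomorph (Homeomorph.subLeft a)⟩

theorem continuous (η : TestFun) : Continuous η := η.contDiff.continuous

theorem hasDerivAt (η : TestFun) (x : ℝ) : HasDerivAt η (η.deriv x) x :=
  (η.contDiff.differentiable (by simp) x).hasDerivAt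

theorem deriv_reflect (η : TestFun) (a t : ℝ) :
    (η.reflect a).deriv t = -η.deriv (a - t) :=
  (((η.hasDerivAt (a - t)).comp t ((hasDerivAt_id t).const_sub a)).deriv).trans (by simp)

theorem memLp (η : TestFun) : MemLp (fun x => (η x : ℂ)) 2 (volume : Measure ℝ) :=
  (Complex.continuous_ofReal.comp η.continuous).memLp_of_hasCompactSupport
    (η.hasCompactSupport.comp_left (g := fun r : ℝ => (r : ℂ)) (by simp))

/-- A test function as an element of `L²(ℝ)`. -/
def toL2 (η : TestFun) : L2 := η.memLp.toLp _

theorem coeFn_toL2 (η : TestFun) : (η.toL2 : ℝ → ℂ) =ᵐ[volume] fun x => (η x : ℂ) :=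
  η.memLp.coeFn_toLp

theorem inner_toL2 (η : TestFun) (f : L2) : inner ℂ η.toL2 f = ∫ x, η x • f x := by
  rw [L2.inner_def]
  refine integral_congr_ae ?_
  filter_upwards [η.coeFn_toL2] with x hx
  rw [hx, RCLike.inner_apply, Complex.conj_ofReal, Complex.real_smul, mul_comm]

theorem norm_toL2_reflect (η : TestFun) (a : ℝ) : ‖(η.reflect a).toL2‖ = ‖η.toL2‖ := by
  rw [toL2, toL2, Lp.norm_toLp, Lp.norm_toLp]
  congr 1
  exact eLpNorm_comp_measurePreserving (g := fun x => ((η x : ℝ) : ℂ)) (f := fun t => a - t)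
    η.memLp.1 (Measure.measurePreserving_sub_left volume a)

end TestFun

/-- Written with inner products against fixed vectors, the relation is visibly closed in `L² × L²`.
-/
theorem hasWeakDeriv_iff {f g : L2} :
    HasWeakDeriv f g ↔ ∀ η : TestFun, inner ℂ η.deriv.toL2 f = -inner ℂ η.toL2 g := by
  refine ⟨fun h η => ?_, fun h η hη hc => ?_⟩
  · rw [TestFun.inner_toL2, TestFun.inner_toL2]
    exact h η η.contDiff η.hasCompactSupport
  · have := h ⟨η, hη, hc⟩
    rwa [TestFun.inner_toL2, TestFun.inner_toL2] at this

/-- An `L²` function which is orthogonal to all test functions supported off a closed null set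
vanishes. -/
theorem eq_zero_of_inner_toL2 {S : Set ℝ} (hS : IsClosed S) (h0 : volume S = 0) {f : L2}
    (h : ∀ η : TestFun, (∀ x ∈ S, η x = 0) → inner ℂ η.toL2 f = 0) : f = 0 := by
  apply Lp.ext
  have h1 := hS.isOpen_compl.ae_eq_zero_of_integral_contDiff_smul_eq_zero (μ := volume)
    (f := (f : ℝ → ℂ)) (((Lp.memLp f).locallyIntegrable (by norm_num)).locallyIntegrableOn _)
    fun η hη hc hs => by
      have := h ⟨η, hη, hc⟩ fun x hx => by
        by_contra hne
        exact hs (subset_tsupport η hne) hx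
      rwa [TestFun.inner_toL2] at this
  filter_upwards [h1, measure_eq_zero_iff_ae_notMem.mp h0, Lp.coeFn_zero ℂ 2 volume]
    with x hx hxS hz
  rw [hx hxS, hz, Pi.zero_apply]

/-- A square integrable solution of `h' = s h` with `s ≠ 0` vanishes. -/
theorem HasWeakDeriv.eq_zero_of_eq_smul {h : L2} {s : ℝ} (hs : s ≠ 0)
    (hw : HasWeakDeriv h ((s : ℂ) • h)) : h = 0 := by
  refine eq_zero_of_inner_toL2 isClosed_empty measure_empty fun ζ _ => ?_
  -- After reflection, `F` is the convolution of `h` with `η`, hence differentiable with `F' = s F`,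
  -- and `F 0` is the inner product sought.
  set η : TestFun := ζ.reflect 0
  set F : ℝ → ℂ := fun a => inner ℂ (η.reflect a).toL2 h with hF
  have hli : LocallyIntegrable (h : ℝ → ℂ) volume := (Lp.memLp h).locallyIntegrable (by norm_num)
  have hconv : F = (h : ℝ → ℂ) ⋆[(ContinuousLinearMap.lsmul ℝ ℝ).flip, volume] (η : ℝ → ℝ) := by
    funext a
    rw [hF]
    simp only [TestFun.inner_toL2]
    rfl
  have hderiv : ∀ a, HasDerivAt F ((s : ℂ) * F a) a := by
    intro a
    have h1 := η.hasCompactSupport.hasDerivAt_convolution_right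
      (ContinuousLinearMap.lsmul ℝ ℝ).flip hli (η.contDiff.of_le (by simp)) a
    rw [← hconv] at h1
    refine h1.congr_deriv (Eq.symm ?_)
    have h2 := hasWeakDeriv_iff.mp hw (η.reflect a)
    rw [inner_smul_right, TestFun.inner_toL2] at h2
    change (s : ℂ) * inner ℂ (η.reflect a).toL2 h = _
    rw [← neg_eq_iff_eq_neg.mpr h2, ← integral_neg]
    refine integral_congr_ae (Eventually.of_forall fun t => ?_)
    simp only [TestFun.deriv_reflect, neg_smul, neg_neg]
    rfl
  have hG : ∀ a, HasDerivAt (fun a : ℝ => Complex.exp (-(s * a : ℂ)) * F a) 0 a := by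
    intro a
    have h1 : HasDerivAt (fun a : ℝ => Complex.exp (-(s * a : ℂ)))
        (Complex.exp (-(s * a : ℂ)) * -(s * 1)) a :=
      ((Complex.ofRealCLM.hasDerivAt (x := a)).const_mul (s : ℂ)).neg.cexp
    exact (h1.mul (hderiv a)).congr_deriv (by ring)
  have hconst : ∀ a : ℝ, Complex.exp (-(s * a : ℂ)) * F a = F 0 := by
    intro a
    have := is_const_of_deriv_eq_zero (fun x => (hG x).differentiableAt) (fun x => (hG x).deriv) a 0
    simpa using this
  -- `F` is bounded by Cauchy–Schwarz, yet `F a = e^{sa} F 0`. The points `a = n / s` go in the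
  -- direction of growth for either sign of `s`.
  have hbd : ∀ n : ℕ, ‖F 0‖ ≤ Real.exp (-n) * (‖η.toL2‖ * ‖h‖) := by
    intro n
    rw [← hconst (n / s), norm_mul, Complex.norm_exp, ← η.norm_toL2_reflect (n / s)]
    refine mul_le_mul (le_of_eq ?_) (norm_inner_le_norm _ _) (norm_nonneg _) (Real.exp_nonneg _)
    congr 1
    rw [← Complex.ofReal_mul, ← Complex.ofReal_neg, Complex.ofReal_re]
    field_simp
  have hlim : Tendsto (fun n : ℕ => Real.exp (-n) * (‖η.toL2‖ * ‖h‖)) atTop (𝓝 0) := by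
    have := (Real.tendsto_exp_neg_atTop_nhds_zero.comp tendsto_natCast_atTop_atTop).mul_const
      (‖η.toL2‖ * ‖h‖)
    simpa using this
  have h0 : F 0 = 0 := norm_le_zero_iff.mp (ge_of_tendsto' hlim hbd)
  have hζ : η.reflect 0 = ζ := by
    refine TestFun.ext (funext fun t => ?_)
    change ζ (0 - (0 - t)) = ζ t
    congr 1
    ring
  rw [← hζ]
  exact h0

/-- The test functions are total in `H¹(ℝ)`. -/
theorem HasWeakDeriv.eq_zero_of_inner {f g : L2} (h : HasWeakDeriv f g)
    (h0 : ∀ η : TestFun, inner ℂ η.toL2 f + inner ℂ η.deriv.toL2 g = 0) : f = 0 := by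
  -- The hypothesis says `f'' = f`, so `f + g` and `f - g` solve `h' = h` and `h' = -h`.
  have h' : HasWeakDeriv g f := hasWeakDeriv_iff.mpr fun η =>
    eq_neg_of_add_eq_zero_right (h0 η)
  have h1 : f + g = 0 := HasWeakDeriv.eq_zero_of_eq_smul (s := 1) one_ne_zero (by
    simpa [add_comm] using h.add h')
  have h2 : f + (-1 : ℂ) • g = 0 :=
    HasWeakDeriv.eq_zero_of_eq_smul (s := -1) (by norm_num) (by
      simpa [add_comm] using h.add (h'.smul (-1)))
  have h3 : (2 : ℂ) • f = 0 := by
    calc (2 : ℂ) • f = (f + g) + (f + (-1 : ℂ) • g) := by module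
      _ = 0 := by rw [h1, h2, add_zero]
  simpa using h3

/-! ### The graph of the weak derivative and dense subspaces of `H¹(ℝ)`. -/

/-- In a Hilbert space, a subspace of a closed subspace which is total in it is dense in it. -/
theorem le_topologicalClosure_of_orthogonal {H : Type*} [NormedAddCommGroup H]
    [InnerProductSpace ℂ H] [CompleteSpace H] {K L : Submodule ℂ H} (hKL : K ≤ L)
    (hL : IsClosed (L : Set H)) (h : ∀ x ∈ L, x ∈ Kᗮ → x = 0) : L ≤ K.topologicalClosure := by
  have hc : K.topologicalClosure ≤ L := K.topologicalClosure_minimal hKL hL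
  have : CompleteSpace K.topologicalClosure :=
    K.isClosed_topologicalClosure.completeSpace_coe
  have h1 := Submodule.sup_orthogonal_inf_of_hasOrthogonalProjection hc
  have h2 : K.topologicalClosureᗮ ⊓ L = ⊥ := by
    rw [eq_bot_iff]
    rintro x ⟨hx, hxL⟩
    rw [Submodule.orthogonal_closure] at hx
    exact h x hxL hx
  rw [h2, sup_bot_eq] at h1
  exact h1.ge

/-- The graph of the weak derivative. -/
def weakGraph : Submodule ℂ (WithLp 2 (L2 × L2)) where
  carrier := {p | HasWeakDeriv p.fst p.snd}
  zero_mem' := hasWeakDeriv_iff.mpr fun η => by simp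
  add_mem' := fun h h' => h.add h'
  smul_mem' := fun c _ h => h.smul c

theorem isClosed_weakGraph : IsClosed (weakGraph : Set (WithLp 2 (L2 × L2))) := by
  have : (weakGraph : Set (WithLp 2 (L2 × L2))) =
      ⋂ η : TestFun, {p | inner ℂ η.deriv.toL2 p.fst = -inner ℂ η.toL2 p.snd} := by
    ext p
    simp only [Set.mem_iInter]
    exact hasWeakDeriv_iff
  rw [this]
  refine isClosed_iInter fun η => isClosed_eq ?_ ?_
  · exact continuous_const.inner (WithLp.continuous_fst 2 L2 L2)
  · exact (continuous_const.inner (WithLp.continuous_snd 2 L2 L2)).neg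

/-- A family in `H¹(ℝ)` which is total in `H¹(ℝ)` spans a dense subspace in `H¹(ℝ)`. -/
theorem weakGraph_le_closure_span {ι : Type*} {u v : ι → L2} (huv : ∀ i, HasWeakDeriv (u i) (v i))
    (h : ∀ f g, HasWeakDeriv f g → (∀ i, inner ℂ (u i) f + inner ℂ (v i) g = 0) → f = 0) :
    weakGraph ≤
      (Submodule.span ℂ (Set.range fun i => WithLp.toLp 2 (u i, v i))).topologicalClosure := by
  refine le_topologicalClosure_of_orthogonal ?_ isClosed_weakGraph ?_
  · rw [Submodule.span_le]
    rintro _ ⟨i, rfl⟩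
    exact huv i
  · intro p hp hpo
    have hp' : HasWeakDeriv p.fst p.snd := hp
    have h1 : p.fst = 0 := h _ _ hp fun i => by
      have := (Submodule.mem_orthogonal _ p).mp hpo _ (Submodule.subset_span ⟨i, rfl⟩)
      rwa [WithLp.prod_inner_apply] at this
    have h2 : p.snd = 0 := by
      refine hp'.unique ?_
      rw [h1]
      exact weakGraph.zero_mem
    rw [← WithLp.ofLp_eq_zero 2]
    exact Prod.ext h1 h2

theorem TestFun.hasWeakDeriv (η : TestFun) : HasWeakDeriv η.toL2 η.deriv.toL2 := by
  rw [hasWeakDeriv_iff]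
  intro ζ
  have e : ∀ ξ χ : TestFun, inner ℂ ξ.toL2 χ.toL2 = ∫ x, ((ξ x * χ x : ℝ) : ℂ) := by
    intro ξ χ
    rw [TestFun.inner_toL2]
    refine integral_congr_ae ?_
    filter_upwards [χ.coeFn_toL2] with x hx
    rw [hx, Complex.real_smul, Complex.ofReal_mul]
  rw [e, e, integral_complex_ofReal, integral_complex_ofReal, ← Complex.ofReal_neg]
  congr 1
  have hi' : ∀ ξ χ : TestFun, Integrable fun x => ξ x * χ x := fun ξ χ =>
    (ξ.continuous.mul χ.continuous).integrable_of_hasCompactSupport ξ.hasCompactSupport.mul_right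
  exact integral_mul_deriv_eq_deriv_mul_of_integrable (fun x _ => ζ.hasDerivAt x)
    (fun x _ => η.hasDerivAt x) (hi' ζ η.deriv) (hi' ζ.deriv η) (hi' ζ η) |> fun h => by
      rw [h, neg_neg]

/-- Test functions are dense in `H¹(ℝ)`. -/
theorem weakGraph_le_closure_testFun : weakGraph ≤ (Submodule.span ℂ
    (Set.range fun η : TestFun => WithLp.toLp 2 (η.toL2, η.deriv.toL2))).topologicalClosure :=
  weakGraph_le_closure_span TestFun.hasWeakDeriv fun _ _ h h0 => h.eq_zero_of_inner h0

/-- Integration by parts in `H¹(ℝ)`. -/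
theorem HasWeakDeriv.inner_eq_neg {f g u v : L2} (h : HasWeakDeriv f g) (h' : HasWeakDeriv u v) :
    inner ℂ v f = -inner ℂ u g := by
  -- Orthogonality of `(u, v)` to the swapped pair `(g, f)` is the claim. It is a closed condition
  -- and holds on test functions by definition.
  let K : Submodule ℂ (WithLp 2 (L2 × L2)) := (ℂ ∙ WithLp.toLp 2 (g, f))ᗮ
  have h1 : weakGraph ≤ K := by
    refine weakGraph_le_closure_testFun.trans (Submodule.topologicalClosure_minimal _ ?_
      (Submodule.isClosed_orthogonal _))
    rw [Submodule.span_le]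
    rintro _ ⟨η, rfl⟩
    refine (Submodule.mem_orthogonal_singleton_iff_inner_left).mpr ?_
    rw [WithLp.prod_inner_apply]
    simp only
    rw [hasWeakDeriv_iff.mp h η, add_neg_cancel]
  have h2 := (Submodule.mem_orthogonal_singleton_iff_inner_left).mp
    (h1 (show WithLp.toLp 2 (u, v) ∈ weakGraph from h'))
  rw [WithLp.prod_inner_apply] at h2
  exact eq_neg_of_add_eq_zero_right h2

/-! ### Selfadjointness of the momentum operator. -/

theorem mem_momentum_domain {f : L2} : f ∈ momentum.domain ↔ ∃ g, HasWeakDeriv f g := Iff.rfl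

theorem HasWeakDeriv.momentum_apply {f g : L2} (h : HasWeakDeriv f g) :
    momentum ⟨f, mem_momentum_domain.mpr ⟨g, h⟩⟩ = Complex.I • g := by
  exact congrArg (Complex.I • ·)
    ((hasWeakDeriv_weakDeriv ⟨f, mem_momentum_domain.mpr ⟨g, h⟩⟩).unique h)

theorem momentum_apply_iff {f : momentum.domain} {g : L2} :
    momentum f = Complex.I • g ↔ HasWeakDeriv f g := by
  obtain ⟨f, g', hg'⟩ := f
  rw [hg'.momentum_apply]
  exact ⟨fun h => smul_right_injective L2 Complex.I_ne_zero h ▸ hg', fun h => by rw [hg'.unique h]⟩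

theorem dense_momentum_domain : Dense (momentum.domain : Set L2) := by
  rw [Submodule.dense_iff_topologicalClosure_eq_top, Submodule.topologicalClosure_eq_top_iff,
    eq_bot_iff]
  intro f hf
  exact eq_zero_of_inner_toL2 isClosed_empty measure_empty fun η _ =>
    hf _ (mem_momentum_domain.mpr ⟨_, η.hasWeakDeriv⟩)

theorem momentum_isFormalAdjoint : momentum.IsFormalAdjoint momentum := by
  rintro ⟨f, f', hf⟩ ⟨g, g', hg⟩
  rw [hf.momentum_apply, hg.momentum_apply, inner_smul_left, inner_smul_right,
    hg.inner_eq_neg hf, Complex.conj_I]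
  ring

/-- Integration by parts gives symmetry. Conversely, pairing `v ∈ D(A*)` with test functions alone
shows that `-i A*v` is its weak derivative. -/
theorem momentum_adjoint : momentum.adjoint = momentum := by
  refine le_antisymm ?_ (momentum_isFormalAdjoint.le_adjoint dense_momentum_domain)
  have h : ∀ v : momentum.adjoint.domain,
      HasWeakDeriv v ((-Complex.I) • momentum.adjoint v) := by
    intro v
    rw [hasWeakDeriv_iff]
    intro η
    have h1 := (LinearPMap.adjoint_isFormalAdjoint dense_momentum_domain).symm
      ⟨η.toL2, mem_momentum_domain.mpr ⟨_, η.hasWeakDeriv⟩⟩ v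
    rw [η.hasWeakDeriv.momentum_apply, inner_smul_left, Complex.conj_I] at h1
    rw [inner_smul_right, ← h1]
    linear_combination (inner ℂ η.deriv.toL2 (v : L2)) * Complex.I_mul_I
  refine ⟨fun v hv => mem_momentum_domain.mpr ⟨_, h ⟨v, hv⟩⟩, ?_⟩
  rintro v w hvw
  have h2 := h v
  rw [hvw, ← momentum_apply_iff] at h2
  rw [h2, smul_smul]
  simp

/-! ### The functions `phi l` as evaluation functionals on `H¹(ℝ)`. -/

/-- The almost everywhere derivative of `phiFun l`. -/
def dphiFun (l : ℝ) (x : ℝ) : ℂ := if x ≤ l then phiFun l x else -phiFun l x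

theorem norm_dphiFun (l x : ℝ) : ‖dphiFun l x‖ = ‖phiFun l x‖ := by
  unfold dphiFun
  split_ifs <;> simp

theorem continuous_phiFun (l : ℝ) : Continuous (phiFun l) := by
  unfold phiFun
  fun_prop

theorem memLp_dphiFun (l : ℝ) : MemLp (dphiFun l) 2 (volume : Measure ℝ) :=
  (memLp_phiFun l).congr_norm
    (Measurable.ite measurableSet_Iic (continuous_phiFun l).measurable
      (continuous_phiFun l).neg.measurable).aestronglyMeasurable
    (Eventually.of_forall fun x => (norm_dphiFun l x).symm)

/-- The weak derivative of `phi l`. -/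
def dphi (l : ℝ) : L2 := (memLp_dphiFun l).toLp (dphiFun l)

theorem norm_phi (l : ℝ) : ‖phi l‖ = ‖phi 0‖ := by
  rw [phi, phi, Lp.norm_toLp, Lp.norm_toLp]
  congr 1
  rw [← eLpNorm_comp_measurePreserving (memLp_phiFun 0).1
    (measurePreserving_sub_right (volume : Measure ℝ) l)]
  congr 1
  funext x
  simp [phiFun]

theorem norm_dphi (l : ℝ) : ‖dphi l‖ = ‖phi 0‖ := by
  rw [← norm_phi l, phi, dphi, Lp.norm_toLp, Lp.norm_toLp]
  congr 1
  exact eLpNorm_congr_norm_ae (Eventually.of_forall fun x => norm_dphiFun l x)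

namespace TestFun

theorem integrable_smul_phiFun (η : TestFun) (l : ℝ) : Integrable fun x => η x • phiFun l x :=
  (η.continuous.smul (continuous_phiFun l)).integrable_of_hasCompactSupport
    η.hasCompactSupport.smul_right

theorem inner_phi (η : TestFun) (l : ℝ) : inner ℂ η.toL2 (phi l) =
    (∫ x in Set.Iic l, η x • phiFun l x) + ∫ x in Set.Ioi l, η x • phiFun l x := by
  rw [intervalIntegral.integral_Iic_add_Ioi (η.integrable_smul_phiFun l).integrableOn
    (η.integrable_smul_phiFun l).integrableOn, inner_toL2]
  refine integral_congr_ae ?_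
  filter_upwards [(memLp_phiFun l).coeFn_toLp] with x hx
  rw [phi, hx]

theorem inner_dphi (η : TestFun) (l : ℝ) : inner ℂ η.toL2 (dphi l) =
    (∫ x in Set.Iic l, η x • phiFun l x) - ∫ x in Set.Ioi l, η x • phiFun l x := by
  have e1 : ∀ x ∈ Set.Iic l, η x • dphiFun l x = η x • phiFun l x := fun x hx => by
    rw [dphiFun, if_pos (Set.mem_Iic.mp hx)]
  have e2 : ∀ x ∈ Set.Ioi l, η x • dphiFun l x = -(η x • phiFun l x) := fun x hx => by
    rw [dphiFun, if_neg (not_le.mpr (Set.mem_Ioi.mp hx)), smul_neg]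
  have h : ∫ x, η x • dphiFun l x = inner ℂ η.toL2 (dphi l) := by
    rw [inner_toL2]
    refine integral_congr_ae ?_
    filter_upwards [(memLp_dphiFun l).coeFn_toLp] with x hx
    rw [dphi, hx]
  rw [← h, ← intervalIntegral.integral_Iic_add_Ioi (b := l)
    ((η.integrable_smul_phiFun l).integrableOn.congr_fun (fun x hx => (e1 x hx).symm)
      measurableSet_Iic)
    ((η.integrable_smul_phiFun l).neg.integrableOn.congr_fun (fun x hx => (e2 x hx).symm)
      measurableSet_Ioi), setIntegral_congr_fun measurableSet_Iic e1,
    setIntegral_congr_fun measurableSet_Ioi e2, integral_neg, sub_eq_add_neg]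

/-- Left of the kink `phiFun l` equals its own derivative, so the integrand is `(η φ)'` and only the
boundary term at `l` survives. With the companion on `Ioi`, the sum of the two identities gives the
weak derivative of `phi l`, and their difference gives the evaluation at `l`. -/
theorem integral_Iic_phiFun (η : TestFun) (l : ℝ) :
    (∫ x in Set.Iic l, η.deriv x • phiFun l x) + ∫ x in Set.Iic l, η x • phiFun l x =
      ((η l / 2 : ℝ) : ℂ) := by
  have hc : ContDiff ℝ 1 fun x => η x * (1 / 2 * Real.exp (x - l)) :=
    (η.contDiff.of_le (by simp)).mul (by fun_prop)
  have hd : ∀ x, _root_.deriv (fun x => η x * (1 / 2 * Real.exp (x - l))) x =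
      (η.deriv x + η x) * (1 / 2 * Real.exp (x - l)) := fun x => by
    refine ((η.hasDerivAt x).mul (((hasDerivAt_id x).sub_const l).exp.const_mul (1 / 2))).deriv.trans ?_
    simp only [id]
    ring
  have h := η.hasCompactSupport.mul_right.integral_Iic_deriv_eq hc l
  rw [← integral_add (η.deriv.integrable_smul_phiFun l).integrableOn
    (η.integrable_smul_phiFun l).integrableOn]
  have h' : ∀ x ∈ Set.Iic l, η.deriv x • phiFun l x + η x • phiFun l x =
      ((_root_.deriv (fun x => η x * (1 / 2 * Real.exp (x - l))) x : ℝ) : ℂ) := fun x hx => by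
    rw [hd, phiFun, abs_of_nonpos (sub_nonpos.mpr (Set.mem_Iic.mp hx)), neg_neg, ← add_smul,
      Complex.real_smul, ← Complex.ofReal_mul]
  rw [setIntegral_congr_fun measurableSet_Iic h', integral_complex_ofReal, h]
  congr 1
  simp
  ring

theorem integral_Ioi_phiFun (η : TestFun) (l : ℝ) :
    (∫ x in Set.Ioi l, η.deriv x • phiFun l x) - ∫ x in Set.Ioi l, η x • phiFun l x =
      -((η l / 2 : ℝ) : ℂ) := by
  have hc : ContDiff ℝ 1 fun x => η x * (1 / 2 * Real.exp (l - x)) :=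
    (η.contDiff.of_le (by simp)).mul (by fun_prop)
  have hd : ∀ x, _root_.deriv (fun x => η x * (1 / 2 * Real.exp (l - x))) x =
      (η.deriv x - η x) * (1 / 2 * Real.exp (l - x)) := fun x => by
    refine ((η.hasDerivAt x).mul (((hasDerivAt_id x).const_sub l).exp.const_mul (1 / 2))).deriv.trans ?_
    simp only [id]
    ring
  have h := η.hasCompactSupport.mul_right.integral_Ioi_deriv_eq hc l
  rw [← integral_sub (η.deriv.integrable_smul_phiFun l).integrableOn
    (η.integrable_smul_phiFun l).integrableOn]
  have h' : ∀ x ∈ Set.Ioi l, η.deriv x • phiFun l x - η x • phiFun l x =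
      ((_root_.deriv (fun x => η x * (1 / 2 * Real.exp (l - x))) x : ℝ) : ℂ) := fun x hx => by
    rw [hd, phiFun, abs_of_pos (sub_pos.mpr (Set.mem_Ioi.mp hx)), neg_sub, ← sub_smul,
      Complex.real_smul, ← Complex.ofReal_mul]
  rw [setIntegral_congr_fun measurableSet_Ioi h', integral_complex_ofReal, h, ← Complex.ofReal_neg]
  congr 1
  simp
  ring

/-- In the graph inner product, `phi l` represents the evaluation at `l`. -/
theorem inner_phi_add_inner_dphi (η : TestFun) (l : ℝ) :
    inner ℂ η.toL2 (phi l) + inner ℂ η.deriv.toL2 (dphi l) = (η l : ℂ) := by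
  rw [inner_phi, inner_dphi]
  have h := η.integral_Iic_phiFun l
  have h' := η.integral_Ioi_phiFun l
  push_cast at h h'
  linear_combination h - h'

end TestFun

theorem hasWeakDeriv_phi (l : ℝ) : HasWeakDeriv (phi l) (dphi l) := by
  rw [hasWeakDeriv_iff]
  intro η
  rw [η.inner_dphi, η.deriv.inner_phi]
  linear_combination η.integral_Iic_phiFun l + η.integral_Ioi_phiFun l

/-- The function `phi l` with its weak derivative. -/
def phiPair (l : ℝ) : WithLp 2 (L2 × L2) := WithLp.toLp 2 (phi l, dphi l)

/-- A test function with its derivative. -/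
def TestFun.pair (η : TestFun) : WithLp 2 (L2 × L2) := WithLp.toLp 2 (η.toL2, η.deriv.toL2)

theorem TestFun.inner_pair_phiPair (η : TestFun) (l : ℝ) :
    inner ℂ η.pair (phiPair l) = (η l : ℂ) := by
  rw [WithLp.prod_inner_apply]
  exact η.inner_phi_add_inner_dphi l

theorem TestFun.inner_phiPair_pair (η : TestFun) (l : ℝ) :
    inner ℂ (phiPair l) η.pair = (η l : ℂ) := by
  rw [← inner_conj_symm, η.inner_pair_phiPair, Complex.conj_ofReal]

/-- By translation invariance all evaluations have the same norm, which yields the uniform Sobolev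
bound for point values. -/
theorem norm_phiPair (l : ℝ) : ‖phiPair l‖ = ‖phiPair 0‖ := by
  rw [WithLp.prod_norm_eq_of_L2, WithLp.prod_norm_eq_of_L2]
  change √(‖phi l‖ ^ 2 + ‖dphi l‖ ^ 2) = √(‖phi 0‖ ^ 2 + ‖dphi 0‖ ^ 2)
  rw [norm_phi l, norm_dphi l, norm_dphi 0]

/-- Elements of the span of the test functions have continuous representatives, which are
evaluated by the inner product with `phiPair`. -/
theorem exists_continuous_of_mem_span {p : WithLp 2 (L2 × L2)}
    (hp : p ∈ Submodule.span ℂ (Set.range TestFun.pair)) :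
    ∃ k : ℝ → ℂ, Continuous k ∧ (p.fst : ℝ → ℂ) =ᵐ[volume] k ∧
      ∀ l, inner ℂ (phiPair l) p = k l := by
  induction hp using Submodule.span_induction with
  | mem p hp =>
    obtain ⟨η, rfl⟩ := hp
    exact ⟨fun x => (η x : ℂ), Complex.continuous_ofReal.comp η.continuous, η.coeFn_toL2,
      η.inner_phiPair_pair⟩
  | zero => exact ⟨0, continuous_zero, Lp.coeFn_zero ℂ 2 volume, fun l => by simp⟩
  | add p q _ _ hp hq =>
    obtain ⟨k, hk, hpk, hl⟩ := hp
    obtain ⟨k', hk', hpk', hl'⟩ := hq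
    refine ⟨k + k', hk.add hk', ?_, fun l => by rw [inner_add_right, hl, hl', Pi.add_apply]⟩
    exact (Lp.coeFn_add p.fst q.fst).trans (hpk.add hpk')
  | smul c p _ hp =>
    obtain ⟨k, hk, hpk, hl⟩ := hp
    refine ⟨c • k, hk.const_smul c, ?_, fun l => by
      rw [inner_smul_right, hl, Pi.smul_apply, smul_eq_mul]⟩
    exact (Lp.coeFn_smul c p.fst).trans (hpk.const_smul c)

/-- A function in `H¹(ℝ)` which vanishes on a dense set is zero. -/
theorem HasWeakDeriv.eq_zero_of_inner_phi {f g : L2} (h : HasWeakDeriv f g) {S : Set ℝ}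
    (hS : Dense S) (h0 : ∀ l ∈ S, inner ℂ (phi l) f + inner ℂ (dphi l) g = 0) : f = 0 := by
  refine eq_zero_of_inner_toL2 isClosed_empty measure_empty fun ξ _ => ?_
  set p : WithLp 2 (L2 × L2) := WithLp.toLp 2 (f, g) with hpdef
  have h0' : ∀ l ∈ S, inner ℂ (phiPair l) p = 0 := fun l hl => by
    rw [WithLp.prod_inner_apply]
    exact h0 l hl
  have hp : p ∈ (Submodule.span ℂ (Set.range TestFun.pair)).topologicalClosure :=
    weakGraph_le_closure_testFun (show p ∈ weakGraph from h)
  have hξ : Integrable fun x => ξ x := ξ.continuous.integrable_of_hasCompactSupport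
    ξ.hasCompactSupport
  set C : ℝ := ‖phiPair 0‖ * (∫ x, ‖ξ x‖) + ‖ξ.toL2‖ with hC
  have hCnn : 0 ≤ C := by positivity
  have key : ∀ ε > 0, ‖inner ℂ ξ.toL2 f‖ ≤ ε * C := by
    intro ε hε
    obtain ⟨q, hq, hpq⟩ := Metric.mem_closure_iff.mp hp ε hε
    rw [dist_eq_norm] at hpq
    obtain ⟨k, hk, hqk, hl⟩ := exists_continuous_of_mem_span hq
    -- On `S` the value `k l` is, up to sign, the evaluation of `p - q`, which is small in norm.
    -- Continuity of `k` spreads the bound from the dense set to the whole line.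
    have hb : ∀ l, ‖k l‖ ≤ ‖phiPair 0‖ * ε := by
      refine fun l => hS.induction (P := fun l => ‖k l‖ ≤ ‖phiPair 0‖ * ε) (fun l hlS => ?_)
        (isClosed_le hk.norm continuous_const) l
      have e : k l = -inner ℂ (phiPair l) (p - q) := by
        rw [inner_sub_right, h0' l hlS, hl, zero_sub, neg_neg]
      rw [e, norm_neg, ← norm_phiPair l]
      exact (norm_inner_le_norm _ _).trans
        (mul_le_mul_of_nonneg_left hpq.le (norm_nonneg _))
    have h1 : ‖inner ℂ ξ.toL2 q.fst‖ ≤ ‖phiPair 0‖ * ε * ∫ x, ‖ξ x‖ := by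
      have e : inner ℂ ξ.toL2 q.fst = ∫ x, ξ x • k x := by
        rw [TestFun.inner_toL2]
        refine integral_congr_ae ?_
        filter_upwards [hqk] with x hx
        rw [hx]
      rw [e, ← integral_const_mul]
      refine norm_integral_le_of_norm_le (hξ.norm.const_mul _) (Eventually.of_forall fun x => ?_)
      rw [norm_smul, mul_comm]
      exact mul_le_mul_of_nonneg_right (hb x) (norm_nonneg _)
    have h2 : ‖inner ℂ ξ.toL2 (p - q).fst‖ ≤ ‖ξ.toL2‖ * ε :=
      (norm_inner_le_norm _ _).trans (mul_le_mul_of_nonneg_left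
        ((WithLp.norm_fst_le (α := L2) (β := L2) (p := 2) _).trans hpq.le) (norm_nonneg _))
    have e : inner ℂ ξ.toL2 f = inner ℂ ξ.toL2 (p - q).fst + inner ℂ ξ.toL2 q.fst := by
      rw [← inner_add_right, WithLp.sub_fst, sub_add_cancel]
      rfl
    rw [e]
    refine (norm_add_le _ _).trans ((add_le_add h2 h1).trans (le_of_eq ?_))
    rw [hC]
    ring
  rw [← norm_le_zero_iff]
  refine le_of_forall_pos_le_add fun ε hε => ?_
  refine (key (ε / (C + 1)) (by positivity)).trans ?_
  rw [zero_add, div_mul_eq_mul_div, div_le_iff₀ (by positivity)]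
  nlinarith

/-! ### Linear independence, spans and closed spans of the functions `phi l`. -/

theorem linearIndependent_phi : LinearIndependent ℂ phi := by
  rw [linearIndependent_iff]
  intro c hc
  ext l
  have hW : ∀ c : ℝ →₀ ℂ, HasWeakDeriv (Finsupp.linearCombination ℂ phi c)
      (Finsupp.linearCombination ℂ dphi c) := by
    intro c
    induction c using Finsupp.induction_linear with
    | zero => exact weakGraph.zero_mem
    | add c d hc hd => simpa using hc.add hd
    | single l a => simpa using (hasWeakDeriv_phi l).smul a
  have hd : Finsupp.linearCombination ℂ dphi c = 0 := by
    refine (hW c).unique ?_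
    rw [hc]
    exact weakGraph.zero_mem
  -- A bump equal to `1` at `l` and `0` at the other indices of `c` extracts the coefficient `c l`
  -- through the evaluation property.
  obtain ⟨η, hη, hηc, hηs, -, hη1⟩ := exists_contDiff_tsupport_subset (n := ⊤) (x := l)
    (s := ((c.support.erase l : Finset ℝ) : Set ℝ)ᶜ)
    ((Finset.finite_toSet _).isClosed.isOpen_compl.mem_nhds (by simp))
  let ζ : TestFun := ⟨η, hηs, hηc⟩
  have h1 : ∀ m ∈ c.support, m ≠ l → η m = 0 := fun m hm hml => by
    by_contra hne
    exact hη (subset_tsupport η hne) (by simpa [hml] using hm)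
  have h2 : inner ℂ ζ.toL2 (Finsupp.linearCombination ℂ phi c) +
      inner ℂ ζ.deriv.toL2 (Finsupp.linearCombination ℂ dphi c) = c l := by
    rw [Finsupp.linearCombination_apply, Finsupp.linearCombination_apply, Finsupp.sum, Finsupp.sum,
      inner_sum, inner_sum, ← Finset.sum_add_distrib]
    have e : ∀ m ∈ c.support, inner ℂ ζ.toL2 (c m • phi m) + inner ℂ ζ.deriv.toL2 (c m • dphi m) =
        if m = l then c l else 0 := by
      intro m hm
      rw [inner_smul_right, inner_smul_right, ← mul_add, ζ.inner_phi_add_inner_dphi]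
      change c m * ((η m : ℝ) : ℂ) = _
      split_ifs with hml
      · rw [hml, hη1, Complex.ofReal_one, mul_one]
      · rw [h1 m hm hml, Complex.ofReal_zero, mul_zero]
    rw [Finset.sum_congr rfl e, Finset.sum_ite_eq']
    split_ifs with hl
    · rfl
    · exact (Finsupp.notMem_support_iff.mp hl).symm
  rw [← h2, hc, hd, inner_zero_right, inner_zero_right, add_zero, Finsupp.coe_zero, Pi.zero_apply]

theorem not_finiteDimensional_span_phi {S : Set ℝ} (hS : S.Infinite) :
    ¬ FiniteDimensional ℂ (Submodule.span ℂ (phi '' S)) := by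
  intro hfin
  have : Infinite S := hS.to_subtype
  have hli : LinearIndependent ℂ fun l : S =>
      (⟨phi l, Submodule.subset_span ⟨l, l.2, rfl⟩⟩ : Submodule.span ℂ (phi '' S)) := by
    refine LinearIndependent.of_comp (Submodule.subtype _) ?_
    exact linearIndependent_phi.comp _ Subtype.val_injective
  exact not_finite_iff_infinite.mpr this hli.finite

/-- Finite sets are closed and null, so results for such index sets apply to single elements of any
span. -/
theorem exists_mem_span_phi_finset {S : Set ℝ} {f : L2} (hf : f ∈ Submodule.span ℂ (phi '' S)) :
    ∃ T : Finset ℝ, f ∈ Submodule.span ℂ (phi '' (T : Set ℝ)) := by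
  obtain ⟨c, -, hc⟩ := (Finsupp.mem_span_image_iff_linearCombination ℂ).mp hf
  exact ⟨c.support, (Finsupp.mem_span_image_iff_linearCombination ℂ).mpr
    ⟨c, Finsupp.mem_supported_support ℂ c, hc⟩⟩

theorem span_phiPair_le_weakGraph (S : Set ℝ) :
    Submodule.span ℂ (phiPair '' S) ≤ weakGraph := by
  rw [Submodule.span_le]
  rintro _ ⟨l, -, rfl⟩
  exact hasWeakDeriv_phi l

theorem mem_span_phi_iff {S : Set ℝ} {f : L2} : f ∈ Submodule.span ℂ (phi '' S) ↔
    ∃ p ∈ Submodule.span ℂ (phiPair '' S), p.fst = f := by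
  have h : Submodule.span ℂ (phi '' S) =
      (Submodule.span ℂ (phiPair '' S)).map (WithLp.fstL 2 ℂ L2 L2).toLinearMap := by
    rw [Submodule.map_span, Set.image_image]
    rfl
  rw [h, Submodule.mem_map]
  rfl

theorem exists_hasWeakDeriv_of_mem_span {S : Set ℝ} {f : L2}
    (hf : f ∈ Submodule.span ℂ (phi '' S)) : ∃ g, HasWeakDeriv f g := by
  obtain ⟨p, hp, rfl⟩ := mem_span_phi_iff.mp hf
  exact ⟨_, span_phiPair_le_weakGraph S hp⟩

theorem mem_span_phiPair {S : Set ℝ} {f g : L2} (hf : f ∈ Submodule.span ℂ (phi '' S))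
    (h : HasWeakDeriv f g) : WithLp.toLp 2 (f, g) ∈ Submodule.span ℂ (phiPair '' S) := by
  obtain ⟨p, hp, rfl⟩ := mem_span_phi_iff.mp hf
  rw [h.unique (span_phiPair_le_weakGraph S hp)]
  exact hp

/-- Vanishing at `l` is orthogonality to `phiPair l`, and orthogonality passes to the closed span.
-/
theorem TestFun.inner_pair_eq_zero {η : TestFun} {S : Set ℝ} (hη : ∀ l ∈ S, η l = 0)
    {p : WithLp 2 (L2 × L2)} (hp : p ∈ (Submodule.span ℂ (phiPair '' S)).topologicalClosure) :
    inner ℂ η.pair p = 0 := by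
  have h : (Submodule.span ℂ (phiPair '' S)).topologicalClosure ≤ (ℂ ∙ η.pair)ᗮ := by
    refine Submodule.topologicalClosure_minimal _ ?_ (Submodule.isClosed_orthogonal _)
    rw [Submodule.span_le]
    rintro _ ⟨l, hl, rfl⟩
    refine Submodule.mem_orthogonal_singleton_iff_inner_right.mpr ?_
    rw [η.inner_pair_phiPair, hη l hl, Complex.ofReal_zero]
  exact Submodule.mem_orthogonal_singleton_iff_inner_right.mp (h hp)

/-- If `S` is a closed null set, then no nonzero element of the closed span of
`{phi l : l ∈ S}` in `H¹(ℝ)` is twice weakly differentiable. -/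
theorem eq_zero_of_mem_closure_span_phiPair {S : Set ℝ} (hS : IsClosed S) (hS0 : volume S = 0)
    {f g k : L2} (hfg : WithLp.toLp 2 (f, g) ∈
      (Submodule.span ℂ (phiPair '' S)).topologicalClosure)
    (hf : HasWeakDeriv f g) (hg : HasWeakDeriv g k) : f = 0 := by
  have h1 : ∀ η : TestFun, inner ℂ η.toL2 f + inner ℂ η.deriv.toL2 g =
      inner ℂ η.toL2 (f - k) := fun η => by
    rw [hasWeakDeriv_iff.mp hg η, inner_sub_right, sub_eq_add_neg]
  -- Here `k = f''`. Test functions vanishing on `S` do not see the closed span, and they suffice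
  -- because `S` is closed and null.
  have h2 : f - k = 0 := eq_zero_of_inner_toL2 hS hS0 fun η hη => by
    rw [← h1]
    have := η.inner_pair_eq_zero hη hfg
    rwa [WithLp.prod_inner_apply] at this
  refine hf.eq_zero_of_inner fun η => ?_
  rw [h1, h2, inner_zero_right]

/-! ### Adjoints, closability and graphs of extensions. -/

section Abstract

variable {H : Type*} [NormedAddCommGroup H] [InnerProductSpace ℂ H] [CompleteSpace H]

theorem adjoint_antitone {S T : H →ₗ.[ℂ] H} (hT : Dense (T.domain : Set H)) (h : T ≤ S) :
    S.adjoint ≤ T.adjoint := by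
  refine LinearPMap.IsFormalAdjoint.le_adjoint hT fun x y => ?_
  have e : T x = S ⟨x, h.1 x.2⟩ := h.2 rfl
  rw [e]
  exact (LinearPMap.adjoint_isFormalAdjoint (hT.mono h.1)).symm ⟨x, h.1 x.2⟩ y

theorem isClosable_of_dense_adjoint {T : H →ₗ.[ℂ] H} (hT : Dense (T.domain : Set H))
    (hT' : Dense (T.adjoint.domain : Set H)) : T.IsClosable :=
  LinearPMap.isClosable_iff_exists_closed_extension.mpr ⟨T.adjoint.adjoint,
    LinearPMap.adjoint_isClosed hT',
    (LinearPMap.adjoint_isFormalAdjoint hT).le_adjoint hT'⟩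

theorem le_extension {A : H →ₗ.[ℂ] H} {M : Submodule ℂ H}
    (h : ExtensionCondition A (M : Set H)) : A ≤ extension A M := by
  refine LinearPMap.le_of_le_graph ?_
  rw [extension_graph A M h]
  intro p hp
  obtain ⟨f, rfl⟩ := (LinearPMap.mem_graph_iff' A).mp hp
  exact ⟨f, 0, M.zero_mem, by simp⟩

theorem mem_extension_graph_iff {A : H →ₗ.[ℂ] H} (hA : A.adjoint = A) {M : Submodule ℂ H}
    (h : ExtensionCondition A (M : Set H)) {p : H × H} : p ∈ (extension A M).graph ↔
      ∃ f φ : A.domain, (φ : H) ∈ M ∧ p = ((f : H) + A φ, A f - (φ : H)) := by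
  rw [extension_graph A M h]
  change (∃ (f : A.domain) (φ : A.adjoint.domain), (φ : H) ∈ M ∧
    p = ((f : H) + A.adjoint φ, A f - (φ : H))) ↔ _
  rw [hA]

end Abstract

/-! ### The condition `(∗)` for the spans and for their graph norm closures. -/

theorem extensionCondition_momentum_iff {M : Set L2} : ExtensionCondition momentum M ↔
    M ⊆ (momentum.domain : Set L2) ∧
    {φ : L2 | ∃ h : φ ∈ momentum.domain, momentum ⟨φ, h⟩ = 0} ∩ M = {0} ∧
    {ψ : L2 | ∃ φ : momentum.domain, (φ : L2) ∈ M ∧ momentum φ = ψ} ∩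
      (momentum.domain : Set L2) = {0} := by
  unfold ExtensionCondition
  rw [momentum_adjoint]

theorem hasWeakDeriv_of_momentum (f : momentum.domain) :
    HasWeakDeriv f (-Complex.I • momentum f) := by
  rw [← momentum_apply_iff, smul_smul]
  simp

/-- If no nonzero element of `M ⊆ H¹(ℝ)` is twice weakly differentiable, then `M` defines an
extension of the momentum operator. -/
theorem extensionCondition_momentum {M : Set L2} (h0 : (0 : L2) ∈ M)
    (hM : ∀ f ∈ M, ∃ g, HasWeakDeriv f g)
    (h : ∀ f ∈ M, ∀ g k, HasWeakDeriv f g → HasWeakDeriv g k → f = 0) :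
    ExtensionCondition momentum M := by
  rw [extensionCondition_momentum_iff]
  refine ⟨hM, Set.Subset.antisymm ?_ ?_, Set.Subset.antisymm ?_ ?_⟩
  · rintro φ ⟨⟨hφ, hφ0⟩, hφM⟩
    have h1 := hasWeakDeriv_of_momentum ⟨φ, hφ⟩
    rw [hφ0, smul_zero] at h1
    -- An element of the kernel has weak derivative `0`, so it is twice weakly differentiable as
    -- well.
    exact h φ hφM 0 0 h1 weakGraph.zero_mem
  · rintro _ rfl
    exact ⟨⟨momentum.domain.zero_mem, momentum.map_zero⟩, h0⟩
  · rintro _ ⟨⟨φ, hφM, rfl⟩, k, hk⟩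
    have h1 : (φ : L2) = 0 := h φ hφM _ _ (hasWeakDeriv_of_momentum φ) (hk.smul _)
    have h2 : φ = 0 := Subtype.ext h1
    rw [h2, LinearPMap.map_zero]
    rfl
  · rintro _ rfl
    exact ⟨⟨0, h0, momentum.map_zero⟩, momentum.domain.zero_mem⟩

theorem graphNorm_momentum {f : momentum.domain} {g : L2} (h : HasWeakDeriv f g) :
    graphNorm momentum f = ‖WithLp.toLp 2 ((f : L2), g)‖ := by
  rw [graphNorm, WithLp.prod_norm_eq_of_L2, momentum_apply_iff.mpr h, norm_smul, Complex.norm_I,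
    one_mul]
  rfl

theorem HasWeakDeriv.sub {f g f' g' : L2} (h : HasWeakDeriv f g) (h' : HasWeakDeriv f' g') :
    HasWeakDeriv (f - f') (g - g') :=
  weakGraph.sub_mem (x := WithLp.toLp 2 (f, g)) (y := WithLp.toLp 2 (f', g')) h h'

/-- Multiplication by `i` is isometric, so the graph norm is the norm of the pair `(f, f')`. This
moves the closure into the Hilbert space `L² × L²`, where orthogonality arguments are available. -/
theorem mem_graphNormClosure_iff {S : Set ℝ} {f g : L2} (h : HasWeakDeriv f g) :
    f ∈ graphNormClosure momentum.adjoint (Submodule.span ℂ (phi '' S) : Set L2) ↔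
      WithLp.toLp 2 (f, g) ∈ (Submodule.span ℂ (phiPair '' S)).topologicalClosure := by
  rw [momentum_adjoint]
  change _ ↔ _ ∈ closure _
  rw [Metric.mem_closure_iff]
  constructor
  · rintro ⟨hf, hε⟩ ε hε0
    obtain ⟨ψ, hψ, hψε⟩ := hε ε hε0
    refine ⟨_, mem_span_phiPair hψ (hasWeakDeriv_of_momentum ψ), ?_⟩
    rw [graphNorm_momentum (f := ⟨f, hf⟩ - ψ) (h.sub (hasWeakDeriv_of_momentum ψ))] at hψε
    rw [dist_eq_norm]
    exact hψε
  · refine fun hε => ⟨⟨g, h⟩, fun ε hε0 => ?_⟩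
    obtain ⟨p, hp, hpε⟩ := hε ε hε0
    have hpw : HasWeakDeriv p.fst p.snd := span_phiPair_le_weakGraph S hp
    refine ⟨⟨p.fst, _, hpw⟩, mem_span_phi_iff.mpr ⟨p, hp, rfl⟩, ?_⟩
    rw [graphNorm_momentum (f := ⟨f, _, h⟩ - ⟨p.fst, _, hpw⟩) (h.sub hpw)]
    rw [dist_eq_norm] at hpε
    exact hpε

theorem MQ_eq : MQ = Submodule.span ℂ (phi '' Set.range ((↑) : ℚ → ℝ)) := by
  rw [MQ, ← Set.range_comp]
  rfl

theorem MZ_eq : MZ = Submodule.span ℂ (phi '' Set.range ((↑) : ℤ → ℝ)) := by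
  rw [MZ, ← Set.range_comp]
  rfl

theorem MZ_le_MQ : MZ ≤ MQ := by
  refine Submodule.span_mono ?_
  rintro _ ⟨z, rfl⟩
  exact ⟨z, by simp⟩

/-- No nonzero finite linear combination of the functions `phi l` is twice weakly
differentiable. -/
theorem eq_zero_of_mem_span_phi {S : Set ℝ} {f g k : L2}
    (hfS : f ∈ Submodule.span ℂ (phi '' S)) (hf : HasWeakDeriv f g) (hg : HasWeakDeriv g k) :
    f = 0 := by
  obtain ⟨T, hT⟩ := exists_mem_span_phi_finset hfS
  exact eq_zero_of_mem_closure_span_phiPair T.finite_toSet.isClosed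
    (T.finite_toSet.measure_zero _)
    (Submodule.le_topologicalClosure _ (mem_span_phiPair hT hf)) hf hg

theorem extensionCondition_span_phi (S : Set ℝ) :
    ExtensionCondition momentum (Submodule.span ℂ (phi '' S) : Set L2) :=
  extensionCondition_momentum (Submodule.zero_mem _) (fun _ => exists_hasWeakDeriv_of_mem_span)
    fun _ hf _ _ => eq_zero_of_mem_span_phi hf

theorem zero_mem_graphNormClosure (S : Set ℝ) : (0 : L2) ∈
    graphNormClosure momentum.adjoint (Submodule.span ℂ (phi '' S) : Set L2) :=
  (mem_graphNormClosure_iff (g := 0) weakGraph.zero_mem).mpr (Submodule.zero_mem _)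

theorem extensionCondition_graphNormClosure {S : Set ℝ} (hS : IsClosed S) (hS0 : volume S = 0) :
    ExtensionCondition momentum
      (graphNormClosure momentum.adjoint (Submodule.span ℂ (phi '' S) : Set L2)) := by
  refine extensionCondition_momentum (zero_mem_graphNormClosure S) ?_ ?_
  · rintro f ⟨hf, -⟩
    rw [momentum_adjoint] at hf
    exact hf
  · intro f hf g k hfg hgk
    exact eq_zero_of_mem_closure_span_phiPair hS hS0 ((mem_graphNormClosure_iff hfg).mp hf) hfg hgk

/-- If `S` is dense, then the functions `phi l`, `l ∈ S`, are total in `H¹(ℝ)`. -/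
theorem mem_closure_span_phiPair_of_dense {S : Set ℝ} (hS : Dense S) {f g : L2}
    (h : HasWeakDeriv f g) :
    WithLp.toLp 2 (f, g) ∈ (Submodule.span ℂ (phiPair '' S)).topologicalClosure := by
  have h1 := weakGraph_le_closure_span (fun l : S => hasWeakDeriv_phi l) fun f g hfg h0 =>
    hfg.eq_zero_of_inner_phi hS fun l hl => h0 ⟨l, hl⟩
  rw [Set.image_eq_range]
  exact h1 h

/-- A bump with zero derivative would be constant, equal to `1` even off its compact support. -/
theorem TestFun.exists_deriv_toL2_ne_zero : ∃ η : TestFun, η.deriv.toL2 ≠ 0 := by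
  obtain ⟨η, -, hηc, hηs, -, hη1⟩ := exists_contDiff_tsupport_subset (n := ⊤) (x := (0 : ℝ))
    (s := Set.univ) univ_mem
  refine ⟨⟨η, hηs, hηc⟩, fun h => ?_⟩
  set ζ : TestFun := ⟨η, hηs, hηc⟩
  have h1 : (fun x => (ζ.deriv x : ℂ)) = fun _ => 0 := by
    refine (Complex.continuous_ofReal.comp ζ.deriv.continuous).ae_eq_iff_eq volume
      continuous_const |>.mp ?_
    have h2 := ζ.deriv.coeFn_toL2
    rw [h] at h2
    exact h2.symm.trans (Lp.coeFn_zero ℂ 2 volume)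
  have h3 : ∀ x y, ζ x = ζ y := is_const_of_deriv_eq_zero
    (fun x => (ζ.hasDerivAt x).differentiableAt) fun x => by
      rw [(ζ.hasDerivAt x).deriv]
      exact_mod_cast congrFun h1 x
  obtain ⟨x, hx⟩ : ∃ x, x ∉ tsupport η := by
    by_contra! hx
    exact noncompact_univ ℝ (by rw [← Set.eq_univ_of_forall hx]; exact hηc)
  have h4 : η x = 1 := (h3 x 0).trans hη1
  rw [image_eq_zero_of_notMem_tsupport hx] at h4
  exact zero_ne_one h4

/-- The closure contains every test function `η`, and `A*η = iη'` again lies in `D(A)`; it is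
nonzero for a suitable `η`. -/
theorem not_extensionCondition_graphNormClosure {S : Set ℝ} (hS : Dense S) :
    ¬ ExtensionCondition momentum
      (graphNormClosure momentum.adjoint (Submodule.span ℂ (phi '' S) : Set L2)) := by
  rw [extensionCondition_momentum_iff]
  rintro ⟨-, -, h⟩
  obtain ⟨η, hη⟩ := TestFun.exists_deriv_toL2_ne_zero
  have h1 : Complex.I • η.deriv.toL2 ∈ ({0} : Set L2) := by
    rw [← h]
    exact ⟨⟨⟨η.toL2, _, η.hasWeakDeriv⟩, (mem_graphNormClosure_iff η.hasWeakDeriv).mpr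
      (mem_closure_span_phiPair_of_dense hS η.hasWeakDeriv), η.hasWeakDeriv.momentum_apply⟩,
      _, η.deriv.hasWeakDeriv.smul _⟩
  exact hη ((smul_eq_zero_iff_right Complex.I_ne_zero).mp h1)

/-! ### Adjoint and closability of the extensions. -/

theorem dense_extension_domain (S : Set ℝ) : Dense
    ((extension momentum (Submodule.span ℂ (phi '' S))).domain : Set L2) :=
  dense_momentum_domain.mono (le_extension (extensionCondition_span_phi S)).1

theorem extension_adjoint_le (S : Set ℝ) :
    (extension momentum (Submodule.span ℂ (phi '' S))).adjoint ≤ momentum.adjoint :=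
  adjoint_antitone dense_momentum_domain (le_extension (extensionCondition_span_phi S))

theorem mem_extension_span_phi_graph {S : Set ℝ} {p : L2 × L2} :
    p ∈ (extension momentum (Submodule.span ℂ (phi '' S))).graph ↔
      ∃ f φ : momentum.domain, (φ : L2) ∈ Submodule.span ℂ (phi '' S) ∧
        p = ((f : L2) + momentum φ, momentum f - (φ : L2)) :=
  mem_extension_graph_iff momentum_adjoint (extensionCondition_span_phi S)

/-- The adjoint of the extension has trivial domain if `S` is dense. -/
theorem extension_adjoint_domain_eq_bot {S : Set ℝ} (hS : Dense S) :
    (extension momentum (Submodule.span ℂ (phi '' S))).adjoint.domain = ⊥ := by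
  set T := extension momentum (Submodule.span ℂ (phi '' S))
  rw [eq_bot_iff]
  intro v hv
  have hle := extension_adjoint_le S
  rw [momentum_adjoint] at hle
  obtain ⟨v', hv'⟩ : ∃ v', HasWeakDeriv v v' := hle.1 hv
  have hTv : T.adjoint ⟨v, hv⟩ = Complex.I • v' := by
    rw [← hv'.momentum_apply]
    exact hle.2 rfl
  refine hv'.eq_zero_of_inner_phi hS fun l hl => ?_
  -- Pairing `v` with this graph element, the case `f = 0`, gives `⟪φ, v⟫ + ⟪φ', v'⟫ = 0` for `φ =
  -- phi l`: `v` vanishes at `l`.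
  have hg : (Complex.I • dphi l, -phi l) ∈ T.graph := by
    refine mem_extension_span_phi_graph.mpr ⟨0, ⟨phi l, _, hasWeakDeriv_phi l⟩,
      Submodule.subset_span ⟨l, hl, rfl⟩, ?_⟩
    rw [(hasWeakDeriv_phi l).momentum_apply, LinearPMap.map_zero]
    simp
  obtain ⟨x, hx, hTx⟩ := (LinearPMap.mem_graph_iff T).mp hg
  have h1 : inner ℂ (T x) v = inner ℂ (x : L2) (T.adjoint ⟨v, hv⟩) :=
    (LinearPMap.adjoint_isFormalAdjoint (dense_extension_domain S)).symm x ⟨v, hv⟩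
  rw [hTv] at h1
  simp only at hx hTx
  rw [hTx, hx, inner_neg_left, inner_smul_left, inner_smul_right, Complex.conj_I] at h1
  linear_combination -h1 + inner ℂ (dphi l) v' * Complex.I_mul_I

/-- The extension is not closable if `S` is dense. -/
theorem not_isClosable_extension {S : Set ℝ} (hS : Dense S) :
    ¬ (extension momentum (Submodule.span ℂ (phi '' S))).IsClosable := by
  rintro ⟨T, hT⟩
  obtain ⟨η, hη⟩ := TestFun.exists_deriv_toL2_ne_zero
  have hmem : ((0 : L2), η.deriv.deriv.toL2 - η.toL2) ∈ T.graph := by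
    rw [← hT]
    have hcl := mem_closure_span_phiPair_of_dense hS η.hasWeakDeriv
    -- `F` sends `(φ, φ')` to the graph point of `f + A*φ` with `f = -iη'` fixed. As `φ → η` in
    -- `H¹`, the first component tends to `0` and the second to `η'' - η`.
    let F : WithLp 2 (L2 × L2) → L2 × L2 := fun p =>
      ((-Complex.I) • η.deriv.toL2 + Complex.I • p.snd, η.deriv.deriv.toL2 - p.fst)
    have hF : Continuous F := by fun_prop
    have h1 := map_mem_closure (t := ((extension momentum
      (Submodule.span ℂ (phi '' S))).graph : Set (L2 × L2))) hF hcl fun p hp => by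
        have hpw : HasWeakDeriv p.fst p.snd := span_phiPair_le_weakGraph S hp
        have hηw := η.deriv.hasWeakDeriv.smul (-Complex.I)
        refine mem_extension_span_phi_graph.mpr ⟨⟨_, _, hηw⟩, ⟨p.fst, _, hpw⟩,
          mem_span_phi_iff.mpr ⟨p, hp, rfl⟩, ?_⟩
        rw [hηw.momentum_apply, hpw.momentum_apply, smul_smul, mul_neg, Complex.I_mul_I, neg_neg,
          one_smul]
    have h2 : F (WithLp.toLp 2 (η.toL2, η.deriv.toL2)) =
        ((0 : L2), η.deriv.deriv.toL2 - η.toL2) := by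
      simp [F]
    rw [h2] at h1
    exact h1
  have h0 : η.deriv.deriv.toL2 - η.toL2 = 0 := T.graph_fst_eq_zero_snd hmem rfl
  -- A closed extension would force `η'' = η`, which has no nonzero solution in `H¹`.
  have h1 : η.toL2 = 0 := η.hasWeakDeriv.eq_zero_of_inner fun ζ => by
    rw [hasWeakDeriv_iff.mp η.deriv.hasWeakDeriv ζ, ← sub_eq_add_neg, ← inner_sub_right,
      ← neg_sub, h0, neg_zero, inner_zero_right]
  refine hη (η.hasWeakDeriv.unique ?_)
  rw [h1]
  exact weakGraph.zero_mem

/-- Test functions vanishing on `S` belong to the domain of the adjoint of the extension. -/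
theorem TestFun.mem_extension_adjoint_domain {η : TestFun} {S : Set ℝ} (hη : ∀ l ∈ S, η l = 0) :
    η.toL2 ∈ (extension momentum (Submodule.span ℂ (phi '' S))).adjoint.domain := by
  refine LinearPMap.mem_adjoint_domain_of_exists _ ⟨Complex.I • η.deriv.toL2, fun x => ?_⟩
  obtain ⟨f, φ, hφ, hx⟩ := mem_extension_span_phi_graph.mp (LinearPMap.mem_graph _ x)
  obtain ⟨hx1, hx2⟩ := Prod.mk.inj hx
  rw [hx1, hx2, inner_add_right, inner_sub_right]
  have h1 := momentum_isFormalAdjoint ⟨η.toL2, _, η.hasWeakDeriv⟩ f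
  rw [η.hasWeakDeriv.momentum_apply] at h1
  obtain ⟨φ, φ', hφ'⟩ := φ
  -- Symmetry of `A` handles `f`; the contribution of `φ` is its graph inner product with `η`, which
  -- vanishes.
  have h2 := TestFun.inner_pair_eq_zero hη
    (Submodule.le_topologicalClosure _ (mem_span_phiPair hφ hφ'))
  rw [WithLp.prod_inner_apply] at h2
  change inner ℂ η.toL2 φ + inner ℂ η.deriv.toL2 φ' = 0 at h2
  rw [h1, hφ'.momentum_apply, inner_smul_left, inner_smul_right, Complex.conj_I]
  linear_combination h2 - inner ℂ η.deriv.toL2 φ' * Complex.I_mul_I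

theorem dense_extension_adjoint_domain {S : Set ℝ} (hS : IsClosed S) (hS0 : volume S = 0) :
    Dense ((extension momentum (Submodule.span ℂ (phi '' S))).adjoint.domain : Set L2) := by
  rw [Submodule.dense_iff_topologicalClosure_eq_top, Submodule.topologicalClosure_eq_top_iff,
    eq_bot_iff]
  intro f hf
  exact eq_zero_of_inner_toL2 hS hS0 fun η hη => hf _ (TestFun.mem_extension_adjoint_domain hη)

end ClosedExt

end

/-! ### The main theorem, with the rationals as dense set and the integers as closed null set. -/

theorem mainTheorem9 :
    -- the momentum operator is densely defined and selfadjoint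
    Dense (ClosedExt.momentum.domain : Set ClosedExt.L2) ∧ IsSelfAdjoint ClosedExt.momentum ∧
    -- both spans are infinite dimensional and satisfy the condition that makes the
    -- extensions well defined
    ¬ FiniteDimensional ℂ ClosedExt.MQ ∧ ¬ FiniteDimensional ℂ ClosedExt.MZ ∧
    ClosedExt.ExtensionCondition ClosedExt.momentum (ClosedExt.MQ : Set ClosedExt.L2) ∧
    ClosedExt.ExtensionCondition ClosedExt.momentum (ClosedExt.MZ : Set ClosedExt.L2) ∧
    (∀ φ : ClosedExt.momentum.adjoint.domain, φ ≠ 0 → ((φ : ClosedExt.L2) ∈ ClosedExt.MQ ∨ (φ : ClosedExt.L2) ∈ ClosedExt.MZ) →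
      ClosedExt.momentum.adjoint φ ∉ ClosedExt.momentum.domain) ∧
    ClosedExt.momentum ≤ ClosedExt.extension ClosedExt.momentum ClosedExt.MQ ∧ ClosedExt.momentum ≤ ClosedExt.extension ClosedExt.momentum ClosedExt.MZ ∧
    -- the rational case: not closable, the adjoint has trivial domain
    ¬ ClosedExt.ExtensionCondition ClosedExt.momentum (ClosedExt.graphNormClosure ClosedExt.momentum.adjoint (ClosedExt.MQ : Set ClosedExt.L2)) ∧
    ¬ (ClosedExt.extension ClosedExt.momentum ClosedExt.MQ).IsClosable ∧
    (ClosedExt.extension ClosedExt.momentum ClosedExt.MQ).adjoint.domain = ⊥ ∧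
    -- the integer case: closable, the adjoint is a densely defined restriction of `A*`
    ClosedExt.ExtensionCondition ClosedExt.momentum (ClosedExt.graphNormClosure ClosedExt.momentum.adjoint (ClosedExt.MZ : Set ClosedExt.L2)) ∧
    (ClosedExt.extension ClosedExt.momentum ClosedExt.MZ).IsClosable ∧
    Dense ((ClosedExt.extension ClosedExt.momentum ClosedExt.MZ).adjoint.domain : Set ClosedExt.L2) ∧
    (ClosedExt.extension ClosedExt.momentum ClosedExt.MZ).adjoint ≤ ClosedExt.momentum.adjoint := by
  have hQ : Dense (Set.range ((↑) : ℚ → ℝ)) := Rat.denseRange_cast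
  have hZ : IsClosed (Set.range ((↑) : ℤ → ℝ)) := Int.isClosedEmbedding_coe_real.isClosed_range
  have hZ0 : MeasureTheory.volume (Set.range ((↑) : ℤ → ℝ)) = 0 :=
    (Set.countable_range _).measure_zero _
  have hnd : ∀ φ : ClosedExt.momentum.adjoint.domain, φ ≠ 0 →
      ((φ : ClosedExt.L2) ∈ ClosedExt.MQ ∨ (φ : ClosedExt.L2) ∈ ClosedExt.MZ) →
      ClosedExt.momentum.adjoint φ ∉ ClosedExt.momentum.domain := by
    rw [ClosedExt.momentum_adjoint]
    rintro φ hφ hM ⟨k, hk⟩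
    have hM' : (φ : ClosedExt.L2) ∈ ClosedExt.MQ := hM.elim id fun h => ClosedExt.MZ_le_MQ h
    rw [ClosedExt.MQ_eq] at hM'
    exact hφ (Subtype.ext (ClosedExt.eq_zero_of_mem_span_phi hM'
      (ClosedExt.hasWeakDeriv_of_momentum φ) (hk.smul _)))
  refine ⟨ClosedExt.dense_momentum_domain,
    LinearPMap.isSelfAdjoint_def.mpr ClosedExt.momentum_adjoint, ?_⟩
  rw [ClosedExt.MQ_eq, ClosedExt.MZ_eq] at hnd ⊢
  exact ⟨ClosedExt.not_finiteDimensional_span_phi (Set.infinite_range_of_injective Rat.cast_injective),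
    ClosedExt.not_finiteDimensional_span_phi (Set.infinite_range_of_injective Int.cast_injective),
    ClosedExt.extensionCondition_span_phi _, ClosedExt.extensionCondition_span_phi _, hnd,
    ClosedExt.le_extension (ClosedExt.extensionCondition_span_phi _),
    ClosedExt.le_extension (ClosedExt.extensionCondition_span_phi _),
    ClosedExt.not_extensionCondition_graphNormClosure hQ,
    ClosedExt.not_isClosable_extension hQ,
    ClosedExt.extension_adjoint_domain_eq_bot hQ,
    ClosedExt.extensionCondition_graphNormClosure hZ hZ0,
    ClosedExt.isClosable_of_dense_adjoint (ClosedExt.dense_extension_domain _)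
      (ClosedExt.dense_extension_adjoint_domain hZ hZ0),
    ClosedExt.dense_extension_adjoint_domain hZ hZ0,
    ClosedExt.extension_adjoint_le _⟩
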